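/- Let $(Z,\mathfrak Z)$ be an arbitrary measurable space with a $\sigma$-finite measure $\nu$. Let $\mathcal M$ be the space of all countable sums of $\mathbb N$-valued measures on $Z$, with the $\sigma$-algebra generated by the maps $\eta\mapsto\eta(B)$, $B\in\mathfrak Z$. Let $\Pi$ be the law of the Poisson point process with intensity $\nu$, that is, the probability measure on $\mathcal M$ such that $$\iint u(\eta,z)\,\eta(dz)\,\Pi(d\eta)=\iint u(\eta+\delta_z,z)\,\Pi(d\eta)\,\nu(dz)$$ for all measurable $u:\mathcal M\times Z\to[0,\infty]$ (Mecke equation). Write $z\in\eta$ if $\eta=\eta'+\delta_z$ for some $\eta'\in\mathcal M$; this $\eta'$ is then unique and is denoted $\eta-\delta_z$. For $F:\mathcal M\to\mathbb R$ put $D^+_zF(\eta)=F(\eta+\delta_z)-F(\eta)$ and $D^-_zF(\eta)=(F(\eta)-F(\eta-\delta_z))1_{z\in\eta}$. Let $D:L^2(\Pi)\to L^2(\Pi\otimes\nu)$ be the unbounded operator with domain $\operatorname{dom}D=\{F\in L^2(\Pi): D^+F\in L^2(\Pi\otimes\nu)\}$ and $DF=D^+F$, and let $\delta=D^*$, with domain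 $\operatorname{dom}\delta\subset L^2(\Pi\otimes\nu)$, be its adjoint. For $v,w:\mathcal M\times Z\to\mathbb R$, let $$[v,w]_-(\eta)=\int v(\eta-\delta_z,z)\,w(\eta-\delta_z,z)\,\eta(dz),$$ where the integrand, which makes sense only for $z\in\eta$, is understood as any measurable function $g$ on $\mathcal M\times Z$ such that, for $\Pi$-almost every $\eta$, $g(\eta,z)=v(\eta-\delta_z,z)\,w(\eta-\delta_z,z)$ for all $z\in\eta$. Let $F\in\operatorname{dom}D$ and $u\in\operatorname{dom}\delta$ be such that $Fu\in\operatorname{dom}\delta$. Then $[DF,u]_-$ exists (there is such a $g$, and $g(\eta,\cdot)$ is $\eta$-integrable for $\Pi$-almost every $\eta$), and, for every version of it, $$\delta(Fu)=F\,\delta u-[DF,u]_-\qquad \Pi\text{-almost surely}.$$ Moreover, for $\Pi$-almost every $\eta$ such that $z\in\eta$ for $\eta$-almost every $z$, the function $z\mapsto D^-_zF(\eta)\,u(\eta-\delta_z,z)$ is $\eta$-integrable and $$\delta(Fu)(\eta)=F(\eta)\,\delta u(\eta)-\int D^-_zF(\eta)\,u(\eta-\delta_z,z)\,\eta(dz).$$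 -/

import Mathlib

open MeasureTheory Filter
open scoped ENNReal

noncomputable section

/-- A measure is `ℕ`-valued if it takes values in `ℕ` on measurable sets. -/
def IsNatValued {Z : Type*} [MeasurableSpace Z] (m : Measure Z) : Prop :=
  ∀ B : Set Z, MeasurableSet B → ∃ k : ℕ, m B = k

/-- The space `𝓜` of all countable sums of `ℕ`-valued measures on `Z`. -/
def Config (Z : Type*) [MeasurableSpace Z] : Type _ :=
  {η : Measure Z // ∃ m : ℕ → Measure Z, (∀ i, IsNatValued (m i)) ∧ η = Measure.sum m}

namespace Config

variable {Z : Type*} [MeasurableSpace Z]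

/-- The measure underlying a configuration. -/
def meas (η : Config Z) : Measure Z := η.1

/-- The σ-algebra generated by the maps `η ↦ η(B)`, `B` measurable. -/
instance : MeasurableSpace (Config Z) :=
  ⨆ (B : Set Z) (_ : MeasurableSet B),
    MeasurableSpace.comap (fun η : Config Z => η.meas B) inferInstance

/-- The configuration `η + δ_z`. -/
def add (η : Config Z) (z : Z) : Config Z :=
  ⟨η.meas + Measure.dirac z, by
    obtain ⟨m, hm, h⟩ := η.2
    refine ⟨fun i => Nat.casesOn i (Measure.dirac z) m, ?_, ?_⟩
    · rintro (_ | i)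
      · intro B hB
        by_cases hz : z ∈ B
        · exact ⟨1, by simp [Measure.dirac_apply' z hB, hz]⟩
        · exact ⟨0, by simp [Measure.dirac_apply' z hB, hz]⟩
      · exact hm i
    · ext B hB
      have h' : η.meas = Measure.sum m := h
      rw [Measure.sum_apply _ hB, tsum_eq_zero_add' ENNReal.summable, h',
        Measure.add_apply, Measure.sum_apply _ hB, add_comm]
      rfl⟩

/-- `z ∈ η`: the configuration `η` has a point at `z`, that is, `η = η' + δ_z` for some
configuration `η'`. -/
def HasPoint (η : Config Z) (z : Z) : Prop := ∃ η' : Config Z, η'.add z = η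

open Classical in
/-- The configuration `η - δ_z` if `z ∈ η` (it is unique), and `η` otherwise. -/
def drop (η : Config Z) (z : Z) : Config Z :=
  if h : η.HasPoint z then h.choose else η

lemma measurable_meas {B : Set Z} (hB : MeasurableSet B) :
    Measurable (fun η : Config Z => η.meas B) := by
  refine Measurable.mono (comap_measurable _) ?_ le_rfl
  exact le_iSup₂_of_le (f := fun (B : Set Z) (_ : MeasurableSet B) =>
    MeasurableSpace.comap (fun η : Config Z => η.meas B) inferInstance) B hB le_rfl

lemma measurable_add : Measurable (fun p : Config Z × Z => p.1.add p.2) := by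
  refine Measurable.of_le_map ?_
  refine iSup₂_le fun B hB => ?_
  rw [MeasurableSpace.comap_le_iff_le_map, MeasurableSpace.map_comp]
  change Measurable (fun p : Config Z × Z => (p.1.meas + Measure.dirac p.2) B)
  simp only [Measure.add_apply]
  refine ((measurable_meas hB).comp measurable_fst).add ?_
  exact (Measure.measurable_coe hB).comp (Measure.measurable_dirac.comp measurable_snd)

end Config

variable {Z : Type*} [MeasurableSpace Z]

/-- `P` is the law of the Poisson point process with intensity `ν`: a probability measure on the
space of configurations that satisfies the Mecke equation. -/
structure IsPoissonLaw (ν : Measure Z) (P : Measure (Config Z)) : Prop where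
  isProbabilityMeasure : IsProbabilityMeasure P
  mecke : ∀ u : Config Z × Z → ℝ≥0∞, Measurable u →
    ∫⁻ η, ∫⁻ z, u (η, z) ∂η.meas ∂P = ∫⁻ z, ∫⁻ η, u (η.add z, z) ∂P ∂ν

/-- The add operator `(η, z) ↦ D⁺_z F(η) = F(η + δ_z) - F(η)`. -/
def addOp (F : Config Z → ℝ) (p : Config Z × Z) : ℝ := F (p.1.add p.2) - F p.1

open Classical in
/-- The drop operator `(η, z) ↦ D⁻_z F(η) = (F(η) - F(η - δ_z)) 1_{z ∈ η}`. -/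
def dropOp (F : Config Z → ℝ) (p : Config Z × Z) : ℝ :=
  if p.1.HasPoint p.2 then F p.1 - F (p.1.drop p.2) else 0

namespace IsPoissonLaw

variable {ν : Measure Z} [SigmaFinite ν] {P : Measure (Config Z)}

lemma quasiMeasurePreserving_add (hP : IsPoissonLaw ν P) :
    Measure.QuasiMeasurePreserving (fun p : Config Z × Z => p.1.add p.2) (P.prod ν) P := by
  have := hP.isProbabilityMeasure
  refine ⟨Config.measurable_add, Measure.AbsolutelyContinuous.mk fun N hN h0 => ?_⟩
  rw [Measure.map_apply Config.measurable_add hN,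
    Measure.prod_apply_symm (Config.measurable_add hN)]
  have hM := hP.mecke (fun p => N.indicator 1 p.1)
    ((measurable_one.indicator hN).comp measurable_fst)
  have hl : ∫⁻ η, ∫⁻ _, N.indicator 1 η ∂η.meas ∂P = 0 := by
    refine (lintegral_congr_ae ?_).trans lintegral_zero
    filter_upwards [measure_eq_zero_iff_ae_notMem.1 h0] with η hη
    simp [hη]
  rw [hl] at hM
  rw [hM]
  refine lintegral_congr fun z => ?_
  have hz : Measurable (fun η : Config Z => η.add z) :=
    Config.measurable_add.comp (measurable_id.prodMk measurable_const)
  exact (lintegral_indicator_one (hz hN)).symm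

lemma addOp_congr (hP : IsPoissonLaw ν P) {F G : Config Z → ℝ} (h : F =ᵐ[P] G) :
    addOp F =ᵐ[P.prod ν] addOp G :=
  (hP.quasiMeasurePreserving_add.ae_eq_comp h).sub
    (Measure.quasiMeasurePreserving_fst.ae_eq_comp h)

lemma addOp_add (hP : IsPoissonLaw ν P) (F G : Lp ℝ 2 P) :
    addOp (F + G : Lp ℝ 2 P) =ᵐ[P.prod ν] addOp F + addOp G := by
  refine (hP.addOp_congr (Lp.coeFn_add F G)).trans (Eventually.of_forall fun p => ?_)
  simp only [addOp, Pi.add_apply]; ring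

lemma addOp_smul (hP : IsPoissonLaw ν P) (c : ℝ) (F : Lp ℝ 2 P) :
    addOp (c • F : Lp ℝ 2 P) =ᵐ[P.prod ν] c • addOp F := by
  refine (hP.addOp_congr (Lp.coeFn_smul c F)).trans (Eventually.of_forall fun p => ?_)
  simp only [addOp, Pi.smul_apply, smul_eq_mul]; ring

/-- The Malliavin derivative `D`, as an unbounded operator `L²(P) → L²(P ⊗ ν)`: its domain
consists of all `F ∈ L²(P)` with `D⁺F ∈ L²(P ⊗ ν)`, and `DF = D⁺F`. -/
def malliavinD (hP : IsPoissonLaw ν P) : Lp ℝ 2 P →ₗ.[ℝ] Lp ℝ 2 (P.prod ν) where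
  domain :=
    { carrier := {F | MemLp (addOp F) 2 (P.prod ν)}
      add_mem' := fun {F G} hF hG => (memLp_congr_ae (hP.addOp_add F G)).2 (hF.add hG)
      zero_mem' := by
        refine (memLp_congr_ae (hP.addOp_congr (Lp.coeFn_zero ℝ 2 P))).2 ?_
        have h : addOp (0 : Config Z → ℝ) = 0 := by ext p; simp [addOp]
        rw [h]; exact MemLp.zero
      smul_mem' := fun c F hF => (memLp_congr_ae (hP.addOp_smul c F)).2 (hF.const_smul c) }
  toFun :=
    { toFun := fun F => MemLp.toLp (addOp (F : Lp ℝ 2 P)) F.2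
      map_add' := fun F G => by
        rw [← MemLp.toLp_add, MemLp.toLp_eq_toLp_iff]
        exact hP.addOp_add F G
      map_smul' := fun c F => by
        rw [RingHom.id_apply, ← MemLp.toLp_const_smul, MemLp.toLp_eq_toLp_iff]
        exact hP.addOp_smul c F }

/-- The divergence `δ = D*`, the adjoint of the unbounded operator `D`. -/
def divergence (hP : IsPoissonLaw ν P) : Lp ℝ 2 (P.prod ν) →ₗ.[ℝ] Lp ℝ 2 P :=
  hP.malliavinD.adjoint

end IsPoissonLaw

/-- `g` is a version of `(η, z) ↦ h(η - δ_z, z)`: this expression makes sense only if `z ∈ η`,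
and `g` is a measurable function on the whole product that agrees with it at all points `z ∈ η`,
for almost all `η`. (By the Mecke equation, `g` is unique up to null sets of the measure
`η(dz) P(dη)`. If `Z` is countably separated, the restriction `z ∈ η` is void, since then, for
every `η`, `η`-almost all `z` satisfy `z ∈ η`.) -/
def IsDropVersion (P : Measure (Config Z)) (h g : Config Z × Z → ℝ) : Prop :=
  Measurable g ∧ ∀ᵐ η ∂P, ∀ z, η.HasPoint z → g (η, z) = h (η.drop z, z)

/-- `R` is (a version of) the bracket `[v, w]₋(η) = ∫ v(η - δ_z, z) w(η - δ_z, z) η(dz)`,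
the integral being absolutely convergent for almost all `η`. -/
def IsBracketMinus (P : Measure (Config Z)) (v w : Config Z × Z → ℝ) (R : Config Z → ℝ) : Prop :=
  ∃ g : Config Z × Z → ℝ, IsDropVersion P (fun p => v p * w p) g ∧
    ∀ᵐ η ∂P, Integrable (fun z => g (η, z)) η.meas ∧ R η = ∫ z, g (η, z) ∂η.meas

end

/-!
The formula is the product rule for the add operator, read through the adjunction `δ = D*`. For an
event `E` the identity
`D(1_E F)(η, z) = 1_E(η + δ_z) DF(η, z) + F(η) D1_E(η, z)`
is multiplied by `u` and integrated over `P ⊗ ν`. If `1_E` and `1_E F` belong to the domain of `D`,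
the left-hand side gives `∫_E F δu dP` and the last term gives `∫_E δ(Fu) dP`. By the Mecke
equation the middle term is `∫_E [DF, u]₋ dP`. So `F δu - δ(Fu) - [DF, u]₋`, which is integrable,
integrates to zero over `E` (`IsPoissonLaw.setIntegral_mul_divergence_sub` and
`IsPoissonLaw.setIntegral_integral_dropVersion`).

The events used are the *local* ones, which are not affected by points added outside a set `B` of
finite `ν`-measure. For them `D1_E` is bounded and vanishes off `Config Z × B`, so that
`F · D1_E` is square integrable for every `F ∈ L²(P)`. They form a π-system that generates the
σ-algebra of `Config Z`, hence they separate integrable functions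
(`Config.ae_eq_zero_of_forall_isLocalEvent`). For the same reason `D` is densely defined, so that
its adjoint satisfies the integration by parts formula and is not a default value.

Two points concern the arbitrary measurable space `Z`, where `{(η, z) | z ∈ η}` need not be
measurable. The map `(η, z) ↦ (η + δ_z, z)` generates the full σ-algebra of `Config Z × Z`
(`Config.comap_addPair`), so every measurable `h` factors through it; the factor is a version of
`h(η - δ_z, z)`. Moreover, `η ↦ η` agrees almost everywhere with an
s-finite kernel (`Config.pointKernel`), and the Mecke equation says that `P ⊗ ν` is mapped to the
composition-product of `P` with this kernel (`IsPoissonLaw.map_addPair`). Integrability and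
measurability of the bracket then follow from Fubini's theorem.
-/

/-! ### Adding and removing points -/

namespace Config

variable {Z : Type*} [MeasurableSpace Z]

lemma add_meas_apply (η : Config Z) (z : Z) (B : Set Z) :
    (η.add z).meas B = η.meas B + Measure.dirac z B := rfl

lemma add_left_cancel {η η' : Config Z} {z : Z} (h : η.add z = η'.add z) : η = η' := by
  refine Subtype.ext (Measure.ext fun B _ => ?_)
  have hB : η.meas B + Measure.dirac z B = η'.meas B + Measure.dirac z B := by
    rw [← add_meas_apply, h, add_meas_apply]
  exact (ENNReal.add_left_inj (measure_ne_top _ _)).1 hB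

lemma add_drop {η : Config Z} {z : Z} (h : η.HasPoint z) : (η.drop z).add z = η := by
  rw [drop, dif_pos h]
  exact h.choose_spec

lemma hasPoint_add (η : Config Z) (z : Z) : (η.add z).HasPoint z := ⟨η, rfl⟩

lemma drop_add (η : Config Z) (z : Z) : (η.add z).drop z = η :=
  add_left_cancel (add_drop (η.hasPoint_add z))

/-- Every point of `η` has mass at least one in each measurable set that contains it; the
singleton `{z}` itself need not be measurable. -/
lemma notMem_of_hasPoint {η : Config Z} {z : Z} (h : η.HasPoint z) {A : Set Z}
    (hA : MeasurableSet A) (h0 : η.meas A = 0) : z ∉ A := by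
  obtain ⟨η', rfl⟩ := h
  intro hz
  rw [add_meas_apply, Measure.dirac_apply' z hA, Set.indicator_of_mem hz] at h0
  simp at h0

lemma measurable_of_measurable_meas {α : Type*} [MeasurableSpace α] {f : α → Config Z}
    (h : ∀ B, MeasurableSet B → Measurable fun a => (f a).meas B) : Measurable f := by
  refine Measurable.of_le_map (iSup₂_le fun B hB => ?_)
  rw [MeasurableSpace.comap_le_iff_le_map, MeasurableSpace.map_comp]
  exact h B hB

/-- The map `(η, z) ↦ (η + δ_z, z)`, which sends `P ⊗ ν` to `η(dz) P(dη)`. -/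
noncomputable def addPair (p : Config Z × Z) : Config Z × Z := (p.1.add p.2, p.2)

lemma measurable_addPair : Measurable (addPair (Z := Z)) :=
  measurable_add.prodMk measurable_snd

/-- Since `η(B) = (η + δ_z)(B) - δ_z(B)`, the pair `(η, z)` can be recovered measurably from
`(η + δ_z, z)`, even where the range of `addPair` is not measurable. -/
lemma comap_addPair :
    MeasurableSpace.comap (addPair (Z := Z)) Prod.instMeasurableSpace =
      Prod.instMeasurableSpace := by
  refine le_antisymm measurable_addPair.comap_le ?_
  -- Both coordinates have to be measurable for the σ-algebra `m` generated by `addPair`.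
  let m : MeasurableSpace (Config Z × Z) :=
    MeasurableSpace.comap addPair Prod.instMeasurableSpace
  have hT : @Measurable _ _ m Prod.instMeasurableSpace (addPair (Z := Z)) := comap_measurable _
  have h2 : Measurable[m] (Prod.snd : Config Z × Z → Z) :=
    (measurable_snd (α := Config Z) (β := Z)).comp (f := addPair) hT
  have h1 : Measurable[m] (Prod.fst : Config Z × Z → Config Z) := by
    refine @measurable_of_measurable_meas Z _ _ m _ fun B hB => ?_
    have e : (fun p : Config Z × Z => p.1.meas B) =
        fun p => (addPair p).1.meas B - Measure.dirac p.2 B := by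
      funext p
      exact (ENNReal.add_sub_cancel_right (measure_ne_top _ _)).symm
    rw [e]
    have ha : Measurable[m] fun p : Config Z × Z => (addPair p).1.meas B :=
      ((measurable_meas hB).comp measurable_fst).comp hT
    have hb : Measurable[m] fun p : Config Z × Z => Measure.dirac p.2 B :=
      ((Measure.measurable_coe hB).comp Measure.measurable_dirac).comp h2
    exact ha.sub hb
  have h : @Measurable _ _ m Prod.instMeasurableSpace (id : Config Z × Z → Config Z × Z) :=
    h1.prodMk h2
  intro s hs
  exact h hs

lemma exists_eq_comp_addPair {h : Config Z × Z → ℝ} (hh : Measurable h) :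
    ∃ g : Config Z × Z → ℝ, Measurable g ∧ h = g ∘ addPair := by
  refine Measurable.exists_eq_measurable_comp (f := addPair) ?_
  rwa [comap_addPair]

lemma exists_measurableSet_preimage_addPair {s : Set (Config Z × Z)} (hs : MeasurableSet s) :
    ∃ t : Set (Config Z × Z), MeasurableSet t ∧ addPair ⁻¹' t = s := by
  rw [← comap_addPair] at hs
  exact hs

/-! ### Configurations as an s-finite kernel -/

open Classical in
/-- The part of `pointKernel` on the `n`-th piece of the partition of `Z` into sets of finite
`ν`-measure, cut off to those configurations `η` that have at least `k` and fewer than `k + 1`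
points there. -/
noncomputable def pointKernelPart (ν : Measure Z) [SigmaFinite ν] (p : ℕ × ℕ) :
    ProbabilityTheory.Kernel (Config Z) Z where
  toFun η := if η.meas (disjointed (spanningSets ν) p.1) ≠ ∞ ∧
      ⌊(η.meas (disjointed (spanningSets ν) p.1)).toReal⌋₊ = p.2
    then η.meas.restrict (disjointed (spanningSets ν) p.1) else 0
  measurable' := by
    have hD : MeasurableSet (disjointed (spanningSets ν) p.1) :=
      MeasurableSet.disjointed (measurableSet_spanningSets ν) p.1
    have hm := measurable_meas hD
    refine Measurable.ite ?_ ?_ measurable_const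
    · exact (hm (measurableSet_singleton _).compl).inter
        ((Nat.measurable_floor.comp hm.ennreal_toReal) (measurableSet_singleton p.2))
    · refine Measure.measurable_of_measurable_coe _ fun B hB => ?_
      simp only [Measure.restrict_apply hB]
      exact measurable_meas (hB.inter hD)

instance (ν : Measure Z) [SigmaFinite ν] (p : ℕ × ℕ) :
    ProbabilityTheory.IsFiniteKernel (pointKernelPart ν p) := by
  -- The number of points on the piece is less than `p.2 + 1` where the kernel is not zero.
  refine ⟨(p.2 : ℝ≥0∞) + 1, by simp, fun η => ?_⟩
  change (if _ then _ else _ : Measure Z) _ ≤ _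
  split_ifs with h
  · rw [Measure.restrict_apply_univ, ← ENNReal.ofReal_toReal h.1]
    refine (ENNReal.ofReal_le_ofReal (Nat.lt_floor_add_one _).le).trans ?_
    rw [h.2, ENNReal.ofReal_add (by positivity) zero_le_one]
    simp
  · simp

/-- A kernel that sends every configuration `η` which is finite on the spanning sets of `ν` to the
measure `η`, and in general to the sum of the restrictions of `η` to those pieces of the partition
on which `η` is finite. The pieces with infinitely many points are left out to make the kernel
s-finite. -/
noncomputable def pointKernel (ν : Measure Z) [SigmaFinite ν] :
    ProbabilityTheory.Kernel (Config Z) Z :=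
  ProbabilityTheory.Kernel.sum (pointKernelPart ν)

instance (ν : Measure Z) [SigmaFinite ν] :
    ProbabilityTheory.IsSFiniteKernel (pointKernel ν) :=
  ProbabilityTheory.Kernel.isSFiniteKernel_sum

lemma pointKernel_apply (ν : Measure Z) [SigmaFinite ν] {η : Config Z}
    (h : ∀ n, η.meas (spanningSets ν n) ≠ ∞) : pointKernel ν η = η.meas := by
  have hD n : η.meas (disjointed (spanningSets ν) n) ≠ ∞ :=
    measure_ne_top_of_subset (disjointed_subset _ _) (h n)
  conv_rhs => rw [← sum_restrict_disjointed_spanningSets η.meas ν]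
  ext B hB
  rw [pointKernel, ProbabilityTheory.Kernel.sum_apply, Measure.sum_apply _ hB,
    Measure.sum_apply _ hB, ENNReal.tsum_prod']
  refine tsum_congr fun n => ?_
  rw [tsum_eq_single ⌊(η.meas (disjointed (spanningSets ν) n)).toReal⌋₊]
  · change (if _ then _ else _ : Measure Z) B = _
    rw [if_pos ⟨hD n, rfl⟩]
  · intro k hk
    change (if _ then _ else _ : Measure Z) B = _
    rw [if_neg fun h => hk h.2.symm]
    simp

end Config

/-! ### The Mecke equation and versions of `h(η - δ_z, z)` -/

namespace IsPoissonLaw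

open Config ProbabilityTheory

variable {Z : Type*} [MeasurableSpace Z] {ν : Measure Z} [SigmaFinite ν] {P : Measure (Config Z)}

/-- By the Mecke equation `∫ η(Sₙ) P(dη) = ν(Sₙ) < ∞`, so almost every `η` is finite on the
spanning sets `Sₙ` of `ν`. -/
lemma pointKernel_ae_eq (hP : IsPoissonLaw ν P) : ∀ᵐ η ∂P, pointKernel ν η = η.meas := by
  have := hP.isProbabilityMeasure
  have h : ∀ᵐ η ∂P, ∀ n, η.meas (spanningSets ν n) < ∞ := by
    refine ae_all_iff.2 fun n => ae_lt_top (measurable_meas (measurableSet_spanningSets ν n)) ?_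
    have hM := hP.mecke (fun p => (spanningSets ν n).indicator 1 p.2)
      ((measurable_one.indicator (measurableSet_spanningSets ν n)).comp measurable_snd)
    simp only [lintegral_indicator_one (measurableSet_spanningSets ν n), lintegral_const,
      measure_univ, mul_one] at hM
    rw [hM]
    exact (measure_spanningSets_lt_top ν n).ne
  filter_upwards [h] with η hη
  exact pointKernel_apply ν fun n => (hη n).ne

/-- The Mecke equation as an equality of measures on `Config Z × Z`. -/
lemma map_addPair (hP : IsPoissonLaw ν P) :
    (P.prod ν).map addPair = P ⊗ₘ pointKernel ν := by
  have := hP.isProbabilityMeasure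
  ext s hs
  rw [Measure.map_apply measurable_addPair hs,
    Measure.prod_apply_symm (measurable_addPair hs), Measure.compProd_apply hs]
  have hM := hP.mecke (s.indicator 1) (measurable_one.indicator hs)
  have hl : ∫⁻ η, ∫⁻ z, s.indicator 1 (η, z) ∂η.meas ∂P =
      ∫⁻ η, pointKernel ν η (Prod.mk η ⁻¹' s) ∂P := by
    refine lintegral_congr_ae ?_
    filter_upwards [hP.pointKernel_ae_eq] with η hη
    rw [hη]
    exact lintegral_indicator_one (measurable_prodMk_left hs)
  rw [← hl, hM]
  refine lintegral_congr fun z => ?_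
  exact (lintegral_indicator_one
    ((measurable_addPair.comp measurable_prodMk_right) hs)).symm

/-- A property of `P ⊗ ν`-almost all pairs `(η, z)` holds, for almost all `η`, at
`(η - δ_z, z)` for *every* `z ∈ η`: an `η`-null measurable set contains no point of `η`. -/
lemma ae_forall_drop (hP : IsPoissonLaw ν P) {p : Config Z × Z → Prop}
    (h : ∀ᵐ x ∂P.prod ν, p x) : ∀ᵐ η ∂P, ∀ z, η.HasPoint z → p (η.drop z, z) := by
  have := hP.isProbabilityMeasure
  obtain ⟨s, hps, hs, hs0⟩ := exists_measurable_superset_of_null (ae_iff.1 h)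
  obtain ⟨t, ht, rfl⟩ := exists_measurableSet_preimage_addPair hs
  rw [← Measure.map_apply measurable_addPair ht, hP.map_addPair] at hs0
  have h0 := Measure.ae_ae_of_ae_compProd (measure_eq_zero_iff_ae_notMem.1 hs0)
  filter_upwards [h0, hP.pointKernel_ae_eq] with η hη hκ z hz
  rw [hκ] at hη
  have hnot := notMem_of_hasPoint hz (A := Prod.mk η ⁻¹' t) (measurable_prodMk_left ht)
    (measure_eq_zero_iff_ae_notMem.2 hη)
  by_contra hp
  refine hnot ?_
  have := hps hp
  rwa [Set.mem_preimage, addPair, add_drop hz] at this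

lemma exists_isDropVersion (hP : IsPoissonLaw ν P) {h : Config Z × Z → ℝ}
    (hh : AEStronglyMeasurable h (P.prod ν)) : ∃ g, IsDropVersion P h g := by
  obtain ⟨g, hg, hgT⟩ := exists_eq_comp_addPair hh.stronglyMeasurable_mk.measurable
  refine ⟨g, hg, ?_⟩
  filter_upwards [hP.ae_forall_drop hh.ae_eq_mk] with η hη z hz
  rw [hη z hz, hgT, Function.comp, addPair, add_drop hz]

/-- All versions of `h(η - δ_z, z)` agree almost everywhere for the measure `η(dz) P(dη)`, since
they are determined on the range of `addPair`. -/
lemma isDropVersion_comp_addPair (hP : IsPoissonLaw ν P) {h g : Config Z × Z → ℝ}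
    (hg : IsDropVersion P h g) : g ∘ addPair =ᵐ[P.prod ν] h := by
  filter_upwards [hP.quasiMeasurePreserving_add.ae hg.2] with p hp
  have := hp p.2 (hasPoint_add _ _)
  rwa [drop_add] at this

lemma integrable_of_isDropVersion (hP : IsPoissonLaw ν P) {h g : Config Z × Z → ℝ}
    (hg : IsDropVersion P h g) (hh : Integrable h (P.prod ν)) :
    Integrable g (P ⊗ₘ pointKernel ν) := by
  rw [← hP.map_addPair, integrable_map_measure hg.1.aestronglyMeasurable
    measurable_addPair.aemeasurable]
  exact hh.congr (hP.isDropVersion_comp_addPair hg).symm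

lemma ae_integrable_of_isDropVersion (hP : IsPoissonLaw ν P) {h g : Config Z × Z → ℝ}
    (hg : IsDropVersion P h g) (hh : Integrable h (P.prod ν)) :
    ∀ᵐ η ∂P, Integrable (fun z => g (η, z)) η.meas := by
  have := hP.isProbabilityMeasure
  filter_upwards [((Measure.integrable_compProd_iff hg.1.aestronglyMeasurable).1
    (hP.integrable_of_isDropVersion hg hh)).1, hP.pointKernel_ae_eq] with η hη hκ
  rwa [hκ] at hη

lemma ae_integral_eq (hP : IsPoissonLaw ν P) {g : Config Z × Z → ℝ} {R : Config Z → ℝ}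
    (hR : ∀ᵐ η ∂P, R η = ∫ z, g (η, z) ∂η.meas) :
    R =ᵐ[P] fun η => ∫ z, g (η, z) ∂pointKernel ν η := by
  filter_upwards [hR, hP.pointKernel_ae_eq] with η hη hκ
  rw [hη, hκ]

lemma integrable_integral_dropVersion (hP : IsPoissonLaw ν P) {h g : Config Z × Z → ℝ}
    (hg : IsDropVersion P h g) (hh : Integrable h (P.prod ν)) {R : Config Z → ℝ}
    (hR : ∀ᵐ η ∂P, R η = ∫ z, g (η, z) ∂η.meas) : Integrable R P := by
  have := hP.isProbabilityMeasure
  exact (hP.integrable_of_isDropVersion hg hh).integral_compProd.congr (hP.ae_integral_eq hR).symm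

/-- The Mecke equation for `1_E(η) h(η - δ_z, z)`. -/
lemma setIntegral_integral_dropVersion (hP : IsPoissonLaw ν P) {h g : Config Z × Z → ℝ}
    (hg : IsDropVersion P h g) (hh : Integrable h (P.prod ν)) {R : Config Z → ℝ}
    (hR : ∀ᵐ η ∂P, R η = ∫ z, g (η, z) ∂η.meas) {E : Set (Config Z)} (hE : MeasurableSet E) :
    ∫ η in E, R η ∂P = ∫ p in {p : Config Z × Z | p.1.add p.2 ∈ E}, h p ∂P.prod ν := by
  have := hP.isProbabilityMeasure
  have hi := hP.integrable_of_isDropVersion hg hh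
  rw [setIntegral_congr_ae hE ((hP.ae_integral_eq hR).mono fun η h _ => h)]
  have h1 := Measure.setIntegral_compProd hE MeasurableSet.univ hi.integrableOn
  simp only [Measure.restrict_univ] at h1
  rw [← h1, ← hP.map_addPair, setIntegral_map (hE.prod MeasurableSet.univ)
    hg.1.aestronglyMeasurable measurable_addPair.aemeasurable]
  have e : addPair ⁻¹' (E ×ˢ Set.univ) = {p : Config Z × Z | p.1.add p.2 ∈ E} := by
    ext p; simp [addPair]
  rw [e]
  exact setIntegral_congr_ae (measurable_add hE)
    ((hP.isDropVersion_comp_addPair hg).mono fun p h _ => h)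

end IsPoissonLaw

/-! ### Local events -/

namespace Config

variable {Z : Type*} [MeasurableSpace Z]

/-- An event is local with respect to `ν` if adding a point outside some set of finite
`ν`-measure does not affect it. -/
def IsLocalEvent (ν : Measure Z) (E : Set (Config Z)) : Prop :=
  MeasurableSet E ∧ ∃ B : Set Z, MeasurableSet B ∧ ν B < ∞ ∧
    ∀ (η : Config Z) (z : Z), z ∉ B → (η.add z ∈ E ↔ η ∈ E)

namespace IsLocalEvent

variable {ν : Measure Z} {E E' : Set (Config Z)}

lemma measurableSet (h : IsLocalEvent ν E) : MeasurableSet E := h.1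

lemma univ : IsLocalEvent ν (Set.univ : Set (Config Z)) :=
  ⟨.univ, ∅, .empty, by simp, by simp⟩

lemma inter (h : IsLocalEvent ν E) (h' : IsLocalEvent ν E') : IsLocalEvent ν (E ∩ E') := by
  obtain ⟨hE, B, hB, hνB, hz⟩ := h
  obtain ⟨hE', B', hB', hνB', hz'⟩ := h'
  refine ⟨hE.inter hE', B ∪ B', hB.union hB',
    (measure_union_le _ _).trans_lt (ENNReal.add_lt_top.2 ⟨hνB, hνB'⟩), fun η z hn => ?_⟩
  rw [Set.mem_union, not_or] at hn
  exact and_congr (hz η z hn.1) (hz' η z hn.2)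

lemma preimage_meas {A : Set Z} (hA : MeasurableSet A) (hνA : ν A < ∞) {S : Set ℝ≥0∞}
    (hS : MeasurableSet S) : IsLocalEvent ν ((fun η : Config Z => η.meas A) ⁻¹' S) := by
  refine ⟨measurable_meas hA hS, A, hA, hνA, fun η z hz => ?_⟩
  simp [add_meas_apply, Measure.dirac_apply' z hA, hz]

end IsLocalEvent

lemma isPiSystem_isLocalEvent (ν : Measure Z) : IsPiSystem {E | IsLocalEvent ν E} :=
  fun _ h _ h' _ => h.inter h'

/-- The local events generate the σ-algebra, because `η(B)` is the limit of `η(B ∩ Sₙ)` along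
spanning sets `Sₙ` of finite `ν`-measure. -/
lemma generateFrom_isLocalEvent (ν : Measure Z) [SigmaFinite ν] :
    (inferInstance : MeasurableSpace (Config Z)) =
      MeasurableSpace.generateFrom {E | IsLocalEvent ν E} := by
  refine le_antisymm ?_ (MeasurableSpace.generateFrom_le fun _ h => h.1)
  refine iSup₂_le fun B hB => Measurable.comap_le ?_
  have e : (fun η : Config Z => η.meas B) = fun η => ⨆ n, η.meas (B ∩ spanningSets ν n) := by
    funext η
    have hm : Monotone fun n => B ∩ spanningSets ν n :=
      fun _ _ h => Set.inter_subset_inter_right _ (monotone_spanningSets ν h)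
    rw [← hm.measure_iUnion, ← Set.inter_iUnion, iUnion_spanningSets, Set.inter_univ]
  rw [e]
  refine Measurable.iSup fun n S hS => MeasurableSpace.measurableSet_generateFrom ?_
  exact IsLocalEvent.preimage_meas (hB.inter (measurableSet_spanningSets ν n))
    ((measure_mono Set.inter_subset_right).trans_lt (measure_spanningSets_lt_top ν n)) hS

lemma ae_eq_zero_of_forall_isLocalEvent (ν : Measure Z) [SigmaFinite ν] {P : Measure (Config Z)}
    {f : Config Z → ℝ} (hf : Integrable f P)
    (h : ∀ E, IsLocalEvent ν E → ∫ η in E, f η ∂P = 0) : f =ᵐ[P] 0 := by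
  suffices h' : ∀ E, MeasurableSet E → ∫ η in E, f η ∂P = 0 from
    hf.ae_eq_zero_of_forall_setIntegral_eq_zero fun E hE _ => h' E hE
  intro E hE
  induction E, hE using MeasurableSpace.induction_on_inter
    (generateFrom_isLocalEvent ν) (isPiSystem_isLocalEvent ν) with
  | empty => simp
  | basic E hE => exact h E hE
  | compl E hE ih =>
    have h1 := h _ IsLocalEvent.univ
    rw [Measure.restrict_univ] at h1
    rw [setIntegral_compl hE hf, h1, ih, sub_zero]
  | iUnion E hd hE ih =>
    rw [integral_iUnion hE hd hf.integrableOn]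
    simp [ih]

end Config

/-! ### The operators `D` and `δ` -/

namespace IsPoissonLaw

open Config

variable {Z : Type*} [MeasurableSpace Z] {ν : Measure Z} [SigmaFinite ν] {P : Measure (Config Z)}

lemma aestronglyMeasurable_addOp (hP : IsPoissonLaw ν P) {F : Config Z → ℝ}
    (hF : AEStronglyMeasurable F P) : AEStronglyMeasurable (addOp F) (P.prod ν) :=
  (hF.comp_quasiMeasurePreserving hP.quasiMeasurePreserving_add).sub
    (hF.comp_quasiMeasurePreserving Measure.quasiMeasurePreserving_fst)

/-- The product rule for `D(1_E F)`. -/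
lemma addOp_indicator (E : Set (Config Z)) (F : Config Z → ℝ) (p : Config Z × Z) :
    addOp (E.indicator F) p =
      {p : Config Z × Z | p.1.add p.2 ∈ E}.indicator (addOp F) p +
        F p.1 * addOp (E.indicator 1) p := by
  by_cases h1 : p.1.add p.2 ∈ E <;> by_cases h2 : p.1 ∈ E <;> simp [addOp, h1, h2]

/-- `D 1_E` is bounded and supported in `Config Z × B` with `ν B < ∞`, so that its product with
any `F ∈ L²(P)` is square integrable. -/
lemma memLp_mul_addOp_indicator (hP : IsPoissonLaw ν P) {E : Set (Config Z)}
    (hE : IsLocalEvent ν E) {F : Config Z → ℝ} (hF : MemLp F 2 P) :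
    MemLp (fun p : Config Z × Z => F p.1 * addOp (E.indicator 1) p) 2 (P.prod ν) := by
  have := hP.isProbabilityMeasure
  obtain ⟨hE, B, hB, hνB, hz⟩ := hE
  have : IsFiniteMeasure (ν.restrict B) := ⟨by rwa [Measure.restrict_apply_univ]⟩
  have h1 : MemLp ((Set.univ ×ˢ B).indicator fun p : Config Z × Z => F p.1) 2 (P.prod ν) := by
    rw [memLp_indicator_iff_restrict (MeasurableSet.univ.prod hB), ← Measure.prod_restrict,
      Measure.restrict_univ]
    exact hF.comp_fst _
  refine h1.mono ?_ (Eventually.of_forall fun p => ?_)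
  · exact (hF.1.comp_quasiMeasurePreserving Measure.quasiMeasurePreserving_fst).mul
      (hP.aestronglyMeasurable_addOp (measurable_one.indicator hE).aestronglyMeasurable)
  · by_cases hp : p.2 ∈ B
    · rw [Set.indicator_of_mem (show p ∈ Set.univ ×ˢ B by simpa using hp), norm_mul]
      refine mul_le_of_le_one_right (norm_nonneg _) ?_
      by_cases h1 : p.1.add p.2 ∈ E <;> by_cases h2 : p.1 ∈ E <;> simp [addOp, h1, h2]
    · have h0 : addOp (E.indicator 1) p = 0 := by
        have := hz p.1 p.2 hp
        by_cases h2 : p.1 ∈ E <;> simp [addOp, this, h2]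
      simp [h0]

lemma memLp_addOp_indicator (hP : IsPoissonLaw ν P) {E : Set (Config Z)}
    (hE : IsLocalEvent ν E) {F : Config Z → ℝ} (hF : MemLp F 2 P)
    (hDF : MemLp (addOp F) 2 (P.prod ν)) : MemLp (addOp (E.indicator F)) 2 (P.prod ν) := by
  have h := (hDF.indicator (measurable_add hE.measurableSet)).add
    (hP.memLp_mul_addOp_indicator hE hF)
  refine h.ae_eq (Eventually.of_forall fun p => ?_)
  exact (addOp_indicator E F p).symm

lemma memLp_addOp_one (μ : Measure (Config Z × Z)) :
    MemLp (addOp (1 : Config Z → ℝ)) 2 μ := by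
  have h : addOp (1 : Config Z → ℝ) = 0 := by ext p; simp [addOp]
  rw [h]
  exact MemLp.zero

lemma toLp_mem_malliavinD_domain (hP : IsPoissonLaw ν P) {F : Config Z → ℝ} (hF : MemLp F 2 P) :
    hF.toLp F ∈ hP.malliavinD.domain ↔ MemLp (addOp F) 2 (P.prod ν) :=
  memLp_congr_ae (hP.addOp_congr hF.coeFn_toLp)

lemma malliavinD_toLp (hP : IsPoissonLaw ν P) {F : Config Z → ℝ} (hF : MemLp F 2 P)
    (h : hF.toLp F ∈ hP.malliavinD.domain) :
    hP.malliavinD ⟨hF.toLp F, h⟩ =ᵐ[P.prod ν] addOp F :=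
  (MemLp.coeFn_toLp (f := addOp (hF.toLp F)) h).trans (hP.addOp_congr hF.coeFn_toLp)

/-- The indicators of local events lie in the domain of `D` and span a dense subspace. -/
lemma dense_malliavinD_domain (hP : IsPoissonLaw ν P) :
    Dense (hP.malliavinD.domain : Set (Lp ℝ 2 P)) := by
  have := hP.isProbabilityMeasure
  rw [Submodule.dense_iff_topologicalClosure_eq_top, Submodule.topologicalClosure_eq_top_iff,
    Submodule.eq_bot_iff]
  intro f hf
  rw [Submodule.mem_orthogonal] at hf
  refine Lp.ext (EventuallyEq.trans ?_ (Lp.coeFn_zero ℝ 2 P).symm)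
  refine ae_eq_zero_of_forall_isLocalEvent ν ((Lp.memLp f).integrable one_le_two) fun E hE => ?_
  have h1 : MemLp (1 : Config Z → ℝ) 2 P := memLp_const 1
  have hE1 := h1.indicator hE.measurableSet
  have h0 := hf _ ((hP.toLp_mem_malliavinD_domain hE1).2
    (hP.memLp_addOp_indicator hE h1 (memLp_addOp_one _)))
  rw [L2.inner_def] at h0
  rw [← h0, ← integral_indicator hE.measurableSet]
  refine integral_congr_ae ?_
  filter_upwards [hE1.coeFn_toLp] with η hη
  rw [hη]
  by_cases h : η ∈ E <;> simp [h]

/-- Integration by parts, for functions instead of classes in `L²`. -/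
lemma integral_divergence_mul (hP : IsPoissonLaw ν P) {u : Config Z × Z → ℝ}
    (hu : MemLp u 2 (P.prod ν)) (huδ : hu.toLp u ∈ hP.divergence.domain)
    {G : Config Z → ℝ} (hG : MemLp G 2 P) (hDG : MemLp (addOp G) 2 (P.prod ν)) :
    ∫ η, hP.divergence ⟨_, huδ⟩ η * G η ∂P = ∫ p, u p * addOp G p ∂P.prod ν := by
  have hG' := (hP.toLp_mem_malliavinD_domain hG).2 hDG
  have h := LinearPMap.adjoint_isFormalAdjoint hP.dense_malliavinD_domain
    ⟨hu.toLp u, huδ⟩ ⟨hG.toLp G, hG'⟩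
  rw [L2.inner_def, L2.inner_def] at h
  refine Eq.trans (integral_congr_ae ?_) (h.trans (integral_congr_ae ?_))
  · filter_upwards [hG.coeFn_toLp] with η hη
    simp only [hη]
    exact mul_comm _ _
  · filter_upwards [hu.coeFn_toLp, hP.malliavinD_toLp hG hG'] with p h1 h2
    simp only [h1, h2]
    simp [mul_comm]

/-- Tested against the indicator of a local event `E`, the difference `F δu - δ(Fu)` is the
integral of `DF · u` over `η + δ_z ∈ E`, by the product rule
`D(1_E F)(η, z) = 1_E(η + δ_z) DF(η, z) + F(η) D1_E(η, z)`. -/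
lemma setIntegral_mul_divergence_sub (hP : IsPoissonLaw ν P)
    {F : Config Z → ℝ} {u : Config Z × Z → ℝ} (hF : MemLp F 2 P) (hu : MemLp u 2 (P.prod ν))
    (hFu : MemLp (fun p : Config Z × Z => F p.1 * u p) 2 (P.prod ν))
    (hDF : MemLp (addOp F) 2 (P.prod ν))
    (huδ : hu.toLp u ∈ hP.divergence.domain)
    (hFuδ : hFu.toLp (fun p : Config Z × Z => F p.1 * u p) ∈ hP.divergence.domain)
    {E : Set (Config Z)} (hE : IsLocalEvent ν E) :
    ∫ η in E, (F η * hP.divergence ⟨_, huδ⟩ η - hP.divergence ⟨_, hFuδ⟩ η) ∂P =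
      ∫ p in {p : Config Z × Z | p.1.add p.2 ∈ E}, addOp F p * u p ∂P.prod ν := by
  have := hP.isProbabilityMeasure
  have h1 : MemLp (1 : Config Z → ℝ) 2 P := memLp_const 1
  have hD1 := hP.memLp_addOp_indicator hE h1 (memLp_addOp_one _)
  have hDE := hP.memLp_addOp_indicator hE hF hDF
  have hm : MeasurableSet {p : Config Z × Z | p.1.add p.2 ∈ E} := measurable_add hE.measurableSet
  have e1 := hP.integral_divergence_mul hu huδ (hF.indicator hE.measurableSet) hDE
  have e2 := hP.integral_divergence_mul hFu hFuδ (h1.indicator hE.measurableSet) hD1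
  have i1 : Integrable (fun η => hP.divergence ⟨_, huδ⟩ η * E.indicator F η) P :=
    (Lp.memLp (hP.divergence ⟨_, huδ⟩)).integrable_mul (hF.indicator hE.measurableSet)
  have i2 : Integrable (fun η => hP.divergence ⟨_, hFuδ⟩ η * E.indicator 1 η) P :=
    (Lp.memLp (hP.divergence ⟨_, hFuδ⟩)).integrable_mul (h1.indicator hE.measurableSet)
  have i3 : Integrable (fun p => u p * addOp (E.indicator F) p) (P.prod ν) :=
    hu.integrable_mul hDE
  have i4 : Integrable (fun p : Config Z × Z => F p.1 * u p * addOp (E.indicator 1) p)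
    (P.prod ν) := hFu.integrable_mul hD1
  rw [← integral_indicator hE.measurableSet, ← integral_indicator hm]
  trans ∫ η, (hP.divergence ⟨_, huδ⟩ η * E.indicator F η -
    hP.divergence ⟨_, hFuδ⟩ η * E.indicator 1 η) ∂P
  · refine integral_congr_ae (Eventually.of_forall fun η => ?_)
    by_cases h : η ∈ E <;> simp [h, mul_comm]
  · rw [integral_sub i1 i2, e1, e2, ← integral_sub i3 i4]
    refine integral_congr_ae (Eventually.of_forall fun p => ?_)
    simp only [addOp_indicator E F p]
    by_cases h : p.1.add p.2 ∈ E
    · simp [h]; ring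
    · simp [h]; ring

end IsPoissonLaw

/-! ### The divergence of a product -/

theorem mainTheorem2 {Z : Type*} [MeasurableSpace Z] (ν : Measure Z) [SigmaFinite ν]
    (P : Measure (Config Z)) (hP : IsPoissonLaw ν P)
    (F : Config Z → ℝ) (u : Config Z × Z → ℝ)
    (hF : MemLp F 2 P) (hu : MemLp u 2 (P.prod ν))
    (hFu : MemLp (fun p : Config Z × Z => F p.1 * u p) 2 (P.prod ν))
    (hFD : hF.toLp F ∈ hP.malliavinD.domain)
    (huδ : hu.toLp u ∈ hP.divergence.domain)
    (hFuδ : hFu.toLp (fun p : Config Z × Z => F p.1 * u p) ∈ hP.divergence.domain) :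
    -- the bracket `[DF, u]₋` exists
    (∃ R : Config Z → ℝ, IsBracketMinus P (addOp F) u R) ∧
    -- the formula `δ(Fu) = F δu - [DF, u]₋`, almost surely
    (∀ R : Config Z → ℝ, IsBracketMinus P (addOp F) u R →
      ∀ᵐ η ∂P, hP.divergence ⟨_, hFuδ⟩ η = F η * hP.divergence ⟨_, huδ⟩ η - R η) ∧
    -- the same pathwise, in terms of the drop operator, where `η - δ_z` makes sense
    -- for `η`-almost all `z`
    (∀ᵐ η ∂P, (∀ᵐ z ∂η.meas, η.HasPoint z) →
      Integrable (fun z => dropOp F (η, z) * u (η.drop z, z)) η.meas ∧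
      hP.divergence ⟨_, hFuδ⟩ η = F η * hP.divergence ⟨_, huδ⟩ η
        - ∫ z, dropOp F (η, z) * u (η.drop z, z) ∂η.meas) := by
  have hDF := (hP.toLp_mem_malliavinD_domain hF).1 hFD
  have hh : Integrable (fun p => addOp F p * u p) (P.prod ν) := hDF.integrable_mul hu
  have hi : Integrable (fun η => F η * hP.divergence ⟨_, huδ⟩ η) P :=
    hF.integrable_mul (Lp.memLp (hP.divergence ⟨_, huδ⟩))
  have := hP.isProbabilityMeasure
  have hi' : Integrable (fun η => hP.divergence ⟨_, hFuδ⟩ η) P :=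
    (Lp.memLp (hP.divergence ⟨_, hFuδ⟩)).integrable one_le_two
  have key : ∀ R : Config Z → ℝ, IsBracketMinus P (addOp F) u R →
      ∀ᵐ η ∂P, hP.divergence ⟨_, hFuδ⟩ η = F η * hP.divergence ⟨_, huδ⟩ η - R η := by
    rintro R ⟨g, hg, hR⟩
    have hR' : ∀ᵐ η ∂P, R η = ∫ z, g (η, z) ∂η.meas := hR.mono fun η h => h.2
    have hRi := hP.integrable_integral_dropVersion hg hh hR'
    have h0 := Config.ae_eq_zero_of_forall_isLocalEvent ν ((hi.sub hi').sub hRi) fun E hE => by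
      simp only [Pi.sub_apply]
      rw [integral_sub (hi.sub hi' : Integrable (fun η => _ - _) P).integrableOn hRi.integrableOn,
        hP.setIntegral_integral_dropVersion hg hh hR' hE.measurableSet]
      exact sub_eq_zero.2 (hP.setIntegral_mul_divergence_sub hF hu hFu hDF huδ hFuδ hE)
    filter_upwards [h0] with η hη
    simp only [Pi.sub_apply, Pi.zero_apply] at hη
    linarith
  obtain ⟨g, hg⟩ := hP.exists_isDropVersion hh.1
  have hgi := hP.ae_integrable_of_isDropVersion hg hh
  have hR : IsBracketMinus P (addOp F) u fun η => ∫ z, g (η, z) ∂η.meas :=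
    ⟨g, hg, hgi.mono fun η h => ⟨h, rfl⟩⟩
  refine ⟨⟨_, hR⟩, key, ?_⟩
  filter_upwards [key _ hR, hgi, hg.2] with η h1 h2 h3 h4
  have e : (fun z => g (η, z)) =ᵐ[η.meas] fun z => dropOp F (η, z) * u (η.drop z, z) := by
    filter_upwards [h4] with z hz
    rw [h3 z hz, dropOp, if_pos hz, addOp, Config.add_drop hz]
  exact ⟨h2.congr e, by rw [h1, integral_congr_ae e]⟩
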